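/- Let $m \ge 2$ and let $k_1,\dots,k_m \ge 1$ be integers. For a field $\mathbb K$, nonzero $\delta_1,\dots,\delta_m \in \mathbb K$ and a size $n$, consider the diagonal word map $\omega : M_n(\mathbb K)^m \to M_n(\mathbb K)$, $$\omega(x_1,\dots,x_m) = \delta_1 x_1^{k_1} + \delta_2 x_2^{k_2} + \cdots + \delta_m x_m^{k_m}.$$ Then: 1. If $\mathbb K = \mathbb C$, then $\omega$ is surjective for every $n$ and all nonzero $\delta_i$; in fact every matrix in $M_n(\mathbb C)$ equals $\omega(x_1,\dots,x_m)$ for some diagonalisable matrices $x_1,\dots,x_m \in M_n(\mathbb C)$. 2. There is a constant $\mathcal N$, depending only on $k_1,\dots,k_m$, such that for every finite field $\mathbb K = \mathbb F_q$ with $q > \mathcal N$, the map $\omega$ is surjective for every $n$ and all nonzero $\delta_i$. 3. If $\mathbb K = \mathbb R$ and at least one of the $k_i$ is odd, then $\omega$ is surjective for every $n$ and all nonzero $\delta_i$. -/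

import Mathlib

/-- The diagonal word map `(x₁, …, xₘ) ↦ δ₁ x₁ ^ k₁ + ⋯ + δₘ xₘ ^ kₘ` on the algebra of `n × n`
matrices over `K`. -/
def diagonalWordMap {K : Type*} [Field K] {m : ℕ} (k : Fin m → ℕ) (δ : Fin m → K) (n : ℕ)
    (x : Fin m → Matrix (Fin n) (Fin n) K) : Matrix (Fin n) (Fin n) K :=
  ∑ i, δ i • x i ^ k i

/-- A square matrix over `K` is diagonalisable (over `K`) if it is conjugate, by an invertible
matrix over `K`, to a diagonal matrix. -/
def IsDiagonalisableMatrix {K : Type*} [Field K] {n : ℕ} (A : Matrix (Fin n) (Fin n) K) : Prop :=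
  ∃ (P : GL (Fin n) K) (d : Fin n → K),
    A = (P : Matrix (Fin n) (Fin n) K) * Matrix.diagonal d *
      ((P⁻¹ : GL (Fin n) K) : Matrix (Fin n) (Fin n) K)

/-! Two variables suffice; the others are set to zero. Over `ℂ`,
`exists_isDiagonalisableMatrix_add_diagonal` splits a matrix into two diagonalisable summands, and
each of these has roots of every order.

Over the other fields, decomposing the space as an `F[X]`-module reduces to a cyclic endomorphism
`T` in dimension `n + 1`. Suppose `w = α z ^ k` generates an algebra `A` of dimension `n + 1`. In
the basis of powers of `w`, multiplication by `w` shifts basis vectors just as `T` does, so the two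
differ by a map of rank one. A rank-one map of trace `β b ^ l` with `b ≠ 0` is `β` times an `l`-th
power. Hence only a condition on traces is left (`isTwoPowerSum_of_cyclic`).

Over `ℝ` with `k` odd, `A = ℝ ^ (n + 1)` works: its elements have arbitrary `k`-th roots, so
distinct eigenvalues can be shifted to the right trace. Over a large finite field with `n ≥ 1`, take
`A = F × L` with `[L : F] = n`. A generic `z` in `L` leaves a nonzero trace `s`, and `α a ^ k + β b
^ l = s` is solved by character sums (`exists_units_diagonal_eq`). -/

/-- The exponential sum `∑ ψ (c uᴷ)` over the units `u` of a finite field. -/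
noncomputable def unitPowSum {F : Type*} [Field F] [Fintype F] [DecidableEq F]
    (ψ : AddChar F ℂ) (K : ℕ) (c : F) : ℂ :=
  ∑ u : Fˣ, ψ ((u : F) ^ K * c)

/-! ### Diagonal equations over large finite fields, by exponential sums. -/

section ExponentialSums

variable {F : Type*} [Field F] [Fintype F] [DecidableEq F]

lemma card_units_mul_pow_eq_le {K : ℕ} (hK : 0 < K) {a : F} (ha : a ≠ 0) (b : F) :
    (Finset.univ.filter fun u : Fˣ => a * (u : F) ^ K = b).card ≤ K := by
  classical
  calc (Finset.univ.filter fun u : Fˣ => a * (u : F) ^ K = b).card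
      ≤ (Polynomial.nthRoots K (b / a)).toFinset.card := by
        refine Finset.card_le_card_of_injOn (fun u : Fˣ => (u : F)) ?_
          (fun _ _ _ _ h => Units.ext h)
        intro u hu
        have hu' : a * (u : F) ^ K = b := by simpa using hu
        simp only [Finset.mem_coe, Multiset.mem_toFinset, Polynomial.mem_nthRoots hK]
        rw [eq_div_iff ha, mul_comm, hu']
    _ ≤ Multiset.card (Polynomial.nthRoots K (b / a)) := Multiset.toFinset_card_le _
    _ ≤ K := Polynomial.card_nthRoots _ _

lemma normSq_unitPowSum (ψ : AddChar F ℂ) (K : ℕ) (c : F) :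
    ((‖unitPowSum ψ K c‖ ^ 2 : ℝ) : ℂ) =
      ∑ u : Fˣ, ∑ v : Fˣ, ψ (c * ((u : F) ^ K - (v : F) ^ K)) := by
  have h := Complex.mul_conj' (unitPowSum ψ K c)
  push_cast
  rw [← h, unitPowSum, map_sum, Finset.sum_mul_sum]
  refine Finset.sum_congr rfl fun u _ => Finset.sum_congr rfl fun v _ => ?_
  rw [← AddChar.map_neg_eq_conj, ← AddChar.map_add_eq_mul]
  congr 1
  ring

/-- By orthogonality of characters the second moment counts pairs with `u ^ K = v ^ K`, and each `u`
has at most `K` partners. -/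
lemma sum_normSq_unitPowSum_le {ψ : AddChar F ℂ} (hψ : ψ.IsPrimitive) {K : ℕ} (hK : 0 < K) :
    ∑ c : F, ‖unitPowSum ψ K c‖ ^ 2 ≤ Fintype.card F * (Fintype.card Fˣ * K) := by
  have h : ((∑ c : F, ‖unitPowSum ψ K c‖ ^ 2 : ℝ) : ℂ) =
      ((Fintype.card F * ∑ u : Fˣ, ((Finset.univ.filter fun v : Fˣ =>
        (1 : F) * (v : F) ^ K = (u : F) ^ K).card : ℝ) : ℝ) : ℂ) := by
    rw [Complex.ofReal_sum]
    simp_rw [normSq_unitPowSum]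
    rw [Finset.sum_comm]
    push_cast
    rw [Finset.mul_sum]
    refine Finset.sum_congr rfl fun u _ => ?_
    rw [Finset.sum_comm]
    simp_rw [AddChar.sum_mulShift _ hψ]
    rw [Finset.card_filter]
    push_cast
    rw [Finset.mul_sum]
    refine Finset.sum_congr rfl fun v _ => ?_
    simp only [sub_eq_zero, one_mul, eq_comm (a := (u : F) ^ K)]
    split_ifs <;> simp
  rw [Complex.ofReal_inj.1 h]
  gcongr
  calc ∑ u : Fˣ, ((Finset.univ.filter fun v : Fˣ =>
        (1 : F) * (v : F) ^ K = (u : F) ^ K).card : ℝ) ≤ ∑ _u : Fˣ, (K : ℝ) :=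
        Finset.sum_le_sum fun u _ => by
          exact_mod_cast card_units_mul_pow_eq_le hK one_ne_zero _
    _ = Fintype.card Fˣ * K := by simp

lemma unitPowSum_mul_pow (ψ : AddChar F ℂ) (K : ℕ) (c : F) (v : Fˣ) :
    unitPowSum ψ K (c * (v : F) ^ K) = unitPowSum ψ K c := by
  refine Fintype.sum_equiv (Equiv.mulRight v) _ _ fun u => ?_
  simp only [Equiv.coe_mulRight, Units.val_mul, mul_pow]
  congr 1
  ring

/-- The sum takes the same value at all points `c * v ^ K`, of which there are at least `|Fˣ| / K`,
so the second moment already bounds a single value. No Weil bound is needed. -/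
lemma normSq_unitPowSum_le {ψ : AddChar F ℂ} (hψ : ψ.IsPrimitive) {K : ℕ} (hK : 0 < K)
    {c : F} (hc : c ≠ 0) : ‖unitPowSum ψ K c‖ ^ 2 ≤ Fintype.card F * (K : ℝ) ^ 2 := by
  have hU : (0 : ℝ) < Fintype.card Fˣ := by exact_mod_cast Fintype.card_pos
  have h1 : Fintype.card Fˣ * ‖unitPowSum ψ K c‖ ^ 2 ≤ K * ∑ x : F, ‖unitPowSum ψ K x‖ ^ 2 := by
    calc Fintype.card Fˣ * ‖unitPowSum ψ K c‖ ^ 2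
        = ∑ u : Fˣ, ‖unitPowSum ψ K (c * (u : F) ^ K)‖ ^ 2 := by
          simp [unitPowSum_mul_pow]
      _ = ∑ x : F, ∑ u ∈ Finset.univ.filter fun u : Fˣ => c * (u : F) ^ K = x,
            ‖unitPowSum ψ K (c * (u : F) ^ K)‖ ^ 2 := 
          (Finset.sum_fiberwise Finset.univ (fun u : Fˣ => c * (u : F) ^ K) _).symm
      _ ≤ ∑ x : F, K * ‖unitPowSum ψ K x‖ ^ 2 := by
          refine Finset.sum_le_sum fun x _ => ?_
          rw [Finset.sum_congr rfl (g := fun _ => ‖unitPowSum ψ K x‖ ^ 2)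
            (fun u hu => by rw [(Finset.mem_filter.1 hu).2]), Finset.sum_const, nsmul_eq_mul]
          gcongr
          exact card_units_mul_pow_eq_le hK hc x
      _ = _ := by rw [Finset.mul_sum]
  have h2 := sum_normSq_unitPowSum_le hψ hK
  have h3 : Fintype.card Fˣ * ‖unitPowSum ψ K c‖ ^ 2 ≤
      Fintype.card Fˣ * (Fintype.card F * (K : ℝ) ^ 2) := by
    refine h1.trans ((mul_le_mul_of_nonneg_left h2 (Nat.cast_nonneg K)).trans_eq ?_)
    ring
  exact le_of_mul_le_mul_left h3 hU

/-- The third unit makes the equation homogeneous, so that its solutions are counted by a product of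
three sums of the same kind. -/
lemma sum_unitPowSum_mul (ψ : AddChar F ℂ) (hψ : ψ.IsPrimitive) (K : ℕ) (a b s : F) :
    ∑ c : F, unitPowSum ψ K (c * a) * unitPowSum ψ K (c * b) * unitPowSum ψ K (c * -s) =
      Fintype.card F * ((Finset.univ.filter fun p : Fˣ × Fˣ × Fˣ =>
        a * (p.1 : F) ^ K + b * (p.2.1 : F) ^ K = s * (p.2.2 : F) ^ K).card : ℂ) := by
  have h : ∀ c : F, unitPowSum ψ K (c * a) * unitPowSum ψ K (c * b) * unitPowSum ψ K (c * -s) =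
      ∑ p : Fˣ × Fˣ × Fˣ, ψ (c * (a * (p.1 : F) ^ K + b * (p.2.1 : F) ^ K
        - s * (p.2.2 : F) ^ K)) := by
    intro c
    simp only [unitPowSum, Fintype.sum_prod_type]
    rw [mul_assoc, Finset.sum_mul]
    refine Finset.sum_congr rfl fun u _ => ?_
    rw [Finset.sum_mul_sum, Finset.mul_sum]
    refine Finset.sum_congr rfl fun v _ => ?_
    rw [Finset.mul_sum]
    refine Finset.sum_congr rfl fun w _ => ?_
    rw [← AddChar.map_add_eq_mul, ← AddChar.map_add_eq_mul]
    congr 1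
    ring
  simp_rw [h]
  rw [Finset.sum_comm]
  simp_rw [AddChar.sum_mulShift _ hψ, sub_eq_zero]
  rw [Finset.card_filter]
  push_cast
  rw [Finset.mul_sum]
  refine Finset.sum_congr rfl fun v _ => ?_
  split_ifs <;> simp

/-- The frequency `c = 0` contributes `|Fˣ| ^ 3`. At the others, one factor is bounded pointwise and
the product of the other two by AM-GM and the second moment. -/
lemma card_units_diagonal_solutions_ge {K : ℕ} (hK : 0 < K) {a b s : F}
    (ha : a ≠ 0) (hb : b ≠ 0) (hs : s ≠ 0) :
    (Fintype.card Fˣ : ℝ) ^ 3 ≤ Fintype.card F * (Finset.univ.filter fun p : Fˣ × Fˣ × Fˣ =>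
        a * (p.1 : F) ^ K + b * (p.2.1 : F) ^ K = s * (p.2.2 : F) ^ K).card +
      √(Fintype.card F) * K * (Fintype.card F * (Fintype.card Fˣ * K)) := by
  obtain ⟨ψ, hψ⟩ : ∃ ψ : AddChar F ℂ, ψ.IsPrimitive :=
    ⟨_, AddChar.FiniteField.primitiveChar_to_Complex_isPrimitive F⟩
  have h := sum_unitPowSum_mul ψ hψ K a b s
  set T := (Finset.univ.filter fun p : Fˣ × Fˣ × Fˣ =>
        a * (p.1 : F) ^ K + b * (p.2.1 : F) ^ K = s * (p.2.2 : F) ^ K).card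
  have h0 : unitPowSum ψ K 0 = Fintype.card Fˣ := by simp [unitPowSum]
  rw [← Finset.add_sum_erase _ _ (Finset.mem_univ (0 : F))] at h
  simp only [zero_mul, h0] at h
  have hshift : ∀ x : F, x ≠ 0 → ∑ c : F, ‖unitPowSum ψ K (c * x)‖ ^ 2 ≤
      Fintype.card F * (Fintype.card Fˣ * K) := fun x hx =>
    (Fintype.sum_equiv (Equiv.mulRight₀ x hx) _ (fun c => ‖unitPowSum ψ K c‖ ^ 2)
      fun c => by simp).trans_le (sum_normSq_unitPowSum_le hψ hK)
  have hb1 : ∀ c : F, c ≠ 0 → ‖unitPowSum ψ K (c * -s)‖ ≤ √(Fintype.card F) * K := by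
    intro c hc
    refine le_of_sq_le_sq ?_ (by positivity)
    rw [mul_pow, Real.sq_sqrt (Nat.cast_nonneg _)]
    exact normSq_unitPowSum_le hψ hK (mul_ne_zero hc (neg_ne_zero.2 hs))
  have herr : ‖∑ c ∈ Finset.univ.erase (0 : F), unitPowSum ψ K (c * a) *
      unitPowSum ψ K (c * b) * unitPowSum ψ K (c * -s)‖ ≤
      √(Fintype.card F) * K * (Fintype.card F * (Fintype.card Fˣ * K)) := by
    calc _ ≤ ∑ c ∈ Finset.univ.erase (0 : F), √(Fintype.card F) * K *
            ((‖unitPowSum ψ K (c * a)‖ ^ 2 + ‖unitPowSum ψ K (c * b)‖ ^ 2) / 2) := by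
          refine (norm_sum_le _ _).trans (Finset.sum_le_sum fun c hc => ?_)
          rw [norm_mul, norm_mul, mul_comm (√_ * _)]
          refine mul_le_mul ?_ (hb1 c (Finset.ne_of_mem_erase hc)) (norm_nonneg _) (by positivity)
          nlinarith [sq_nonneg (‖unitPowSum ψ K (c * a)‖ - ‖unitPowSum ψ K (c * b)‖)]
      _ ≤ ∑ c : F, √(Fintype.card F) * K *
            ((‖unitPowSum ψ K (c * a)‖ ^ 2 + ‖unitPowSum ψ K (c * b)‖ ^ 2) / 2) :=
          Finset.sum_le_sum_of_subset_of_nonneg (Finset.erase_subset _ _)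
            fun _ _ _ => by positivity
      _ = √(Fintype.card F) * K * ((∑ c : F, ‖unitPowSum ψ K (c * a)‖ ^ 2 +
            ∑ c : F, ‖unitPowSum ψ K (c * b)‖ ^ 2) / 2) := by
          rw [← Finset.mul_sum, ← Finset.sum_div, Finset.sum_add_distrib]
      _ ≤ _ := by
          gcongr
          linarith [hshift a ha, hshift b hb]
  have h' := congrArg (fun z : ℂ => ‖z‖) (eq_sub_of_add_eq h)
  have h3 : ‖(Fintype.card Fˣ * Fintype.card Fˣ * Fintype.card Fˣ : ℂ)‖ =
      (Fintype.card Fˣ : ℝ) ^ 3 := by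
    simp; ring
  have h4 := norm_sub_le (Fintype.card F * (T : ℂ)) (∑ c ∈ Finset.univ.erase (0 : F),
    unitPowSum ψ K (c * a) * unitPowSum ψ K (c * b) * unitPowSum ψ K (c * -s))
  rw [← h', h3] at h4
  have h5 : ‖(Fintype.card F * (T : ℂ))‖ = Fintype.card F * (T : ℝ) := by simp
  rw [h5] at h4
  linarith

lemma exists_units_diagonal_eq {K : ℕ} (hK : 0 < K) (hq : 64 * K ^ 4 < Fintype.card F)
    {a b s : F} (ha : a ≠ 0) (hb : b ≠ 0) (hs : s ≠ 0) (r : F) :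
    ∃ u v : Fˣ, a * (u : F) ^ K + b * (v : F) ^ K = s ∧ a * (u : F) ^ K ≠ r := by
  -- Dividing a homogeneous solution by `w` gives a solution for `s`. If all of these had `a * u ^ K
  -- = r`, each `w` would allow at most `K` choices of `u` and `K` of `v`, too few for the lower
  -- bound.
  by_contra! hcon
  have hT : (Finset.univ.filter fun p : Fˣ × Fˣ × Fˣ =>
        a * (p.1 : F) ^ K + b * (p.2.1 : F) ^ K = s * (p.2.2 : F) ^ K).card ≤
        Fintype.card Fˣ * (K * K) := by
    calc _ ≤ (Finset.univ.sigma fun w : Fˣ =>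
          (Finset.univ.filter fun u : Fˣ => a * (u : F) ^ K = r * (w : F) ^ K) ×ˢ
          (Finset.univ.filter fun v : Fˣ => b * (v : F) ^ K = (s - r) * (w : F) ^ K)).card := by
          refine Finset.card_le_card_of_injOn (fun p => ⟨p.2.2, p.1, p.2.1⟩) ?_ ?_
          · rintro ⟨u, v, w⟩ hp
            have hp' : a * (u : F) ^ K + b * (v : F) ^ K = s * (w : F) ^ K := by simpa using hp
            have hw : (w : F) ^ K ≠ 0 := pow_ne_zero _ w.ne_zero
            have hu := hcon (u / w) (v / w) (by
              simp only [Units.val_div_eq_div_val, div_pow]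
              field_simp
              linear_combination hp')
            simp only [Units.val_div_eq_div_val, div_pow] at hu
            have hu' : a * (u : F) ^ K = r * (w : F) ^ K := by
              rw [← hu]; field_simp
            simp only [Finset.mem_coe, Finset.mem_sigma, Finset.mem_univ, Finset.mem_product,
              Finset.mem_filter, true_and]
            exact ⟨hu', by linear_combination hp' - hu'⟩
          · rintro ⟨u, v, w⟩ _ ⟨u', v', w'⟩ _ h
            simp only [Sigma.mk.injEq, heq_eq_eq, Prod.mk.injEq] at h
            obtain ⟨rfl, rfl, rfl⟩ := h
            rfl
      _ ≤ ∑ _w : Fˣ, K * K := by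
          rw [Finset.card_sigma]
          refine Finset.sum_le_sum fun w _ => ?_
          rw [Finset.card_product]
          exact Nat.mul_le_mul (card_units_mul_pow_eq_le hK ha _)
            (card_units_mul_pow_eq_le hK hb _)
      _ = _ := by simp
  have hmain := card_units_diagonal_solutions_ge hK ha hb hs
  set q : ℝ := (Fintype.card F : ℝ) with hqdef
  have hU : (Fintype.card Fˣ : ℝ) = q - 1 := by
    rw [Fintype.card_units, Nat.cast_sub Fintype.card_pos]; simp [hqdef]
  have hT' : ((Finset.univ.filter fun p : Fˣ × Fˣ × Fˣ =>
        a * (p.1 : F) ^ K + b * (p.2.1 : F) ^ K = s * (p.2.2 : F) ^ K).card : ℝ) ≤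
        (q - 1) * (K * K) := by
    rw [← hU]; exact_mod_cast hT
  have hq' : 64 * (K : ℝ) ^ 4 < q := by rw [hqdef]; exact_mod_cast hq
  have hK1 : (1 : ℝ) ≤ K := by exact_mod_cast hK
  have hK4 : (1 : ℝ) ≤ (K : ℝ) ^ 4 := one_le_pow₀ hK1
  rw [hU] at hmain
  set t := √q with ht
  have hq0 : 0 ≤ q := by linarith
  have htq : t ^ 2 = q := Real.sq_sqrt hq0
  have ht8 : 8 * (K : ℝ) ^ 2 < t := by
    refine Real.lt_sqrt_of_sq_lt ?_
    nlinarith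
  have hKK : (1 : ℝ) ≤ (K : ℝ) ^ 2 := one_le_pow₀ hK1
  have h1 : (q - 1) ^ 3 ≤ (q - 1) * (q * (K ^ 2 * (1 + t))) := by
    refine hmain.trans ?_
    nlinarith [mul_le_mul_of_nonneg_left hT' hq0]
  have h2 : (q - 1) ^ 2 ≤ q * (K ^ 2 * (1 + t)) := by
    refine le_of_mul_le_mul_left (a := q - 1) ?_ (by linarith)
    linarith [h1, show (q - 1) ^ 3 = (q - 1) * (q - 1) ^ 2 by ring]
  -- Since `√q > 8 K ^ 2`, this gives `(q - 1) ^ 2 ≤ q ^ 2 / 4`, which is false for `q > 64`.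
  have h3 : (K : ℝ) ^ 2 * (1 + t) ≤ t / 8 * (2 * t) := by
    refine mul_le_mul (by linarith) (by linarith) (by linarith) (by linarith)
  have h4 : q * (K ^ 2 * (1 + t)) ≤ q * (q / 4) := by
    refine mul_le_mul_of_nonneg_left (h3.trans_eq ?_) hq0
    rw [← htq]; ring
  nlinarith

end ExponentialSums

/-- A `(k * l)`-th power is both a `k`-th and an `l`-th power, so a common exponent suffices. -/
lemma exists_diagonal_eq_of_card_gt {F : Type*} [Field F] [Finite F] {k l : ℕ} (hk : 1 ≤ k)
    (hl : 1 ≤ l) (hq : 64 * (k * l) ^ 4 < Nat.card F) {α β s : F} (hα : α ≠ 0) (hβ : β ≠ 0)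
    (hs : s ≠ 0) (r : F) :
    ∃ a b : F, b ≠ 0 ∧ α * a ^ k + β * b ^ l = s ∧ α * a ^ k ≠ r := by
  classical
  have := Fintype.ofFinite F
  rw [Nat.card_eq_fintype_card] at hq
  obtain ⟨u, v, h, hr⟩ := exists_units_diagonal_eq (Nat.mul_pos hk hl) hq hα hβ hs r
  refine ⟨(u : F) ^ l, (v : F) ^ k, pow_ne_zero _ v.ne_zero, ?_, ?_⟩
  · rw [← pow_mul, ← pow_mul, mul_comm l k, h]
  · rwa [← pow_mul, mul_comm l k]

/-! ### Reduction to cyclic endomorphisms and rank-one corrections. -/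

/-- An endomorphism of the form `α xᵏ + β yˡ`. -/
def IsTwoPowerSum {F V : Type*} [Field F] [AddCommGroup V] [Module F V] (α β : F) (k l : ℕ)
    (T : Module.End F V) : Prop :=
  ∃ x y : Module.End F V, T = α • x ^ k + β • y ^ l

section TwoPowerSum

open Polynomial

variable {F V W : Type*} [Field F] [AddCommGroup V] [Module F V] [AddCommGroup W] [Module F W]
  {α β : F} {k l : ℕ}

lemma IsTwoPowerSum.conj {T : Module.End F V} {S : Module.End F W}
    (hT : IsTwoPowerSum α β k l T) (e : V ≃ₗ[F] W) (h : ∀ v, e (T v) = S (e v)) :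
    IsTwoPowerSum α β k l S := by
  obtain ⟨x, y, rfl⟩ := hT
  refine ⟨LinearEquiv.conjAlgEquiv F e x, LinearEquiv.conjAlgEquiv F e y, ?_⟩
  rw [← map_pow, ← map_pow, ← map_smul, ← map_smul, ← map_add]
  ext w
  obtain ⟨v, rfl⟩ := e.surjective w
  rw [← h]
  simp [LinearEquiv.conjAlgEquiv_apply]

lemma IsTwoPowerSum.pi {ι : Type*} {M : ι → Type*} [∀ i, AddCommGroup (M i)]
    [∀ i, Module F (M i)] {T : ∀ i, Module.End F (M i)}
    (hT : ∀ i, IsTwoPowerSum α β k l (T i)) :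
    IsTwoPowerSum α β k l (LinearMap.pi fun i => T i ∘ₗ LinearMap.proj i) := by
  choose x y h using hT
  have hpow : ∀ (z : ∀ i, Module.End F (M i)) (n : ℕ) (v : ∀ i, M i) (i : ι),
      ((LinearMap.pi fun i => z i ∘ₗ LinearMap.proj i : Module.End F (∀ i, M i)) ^ n) v i =
        (z i ^ n) (v i) := by
    intro z n
    induction n with
    | zero => intro v i; simp
    | succ n ih => intro v i; rw [pow_succ, pow_succ, Module.End.mul_apply, ih]; simp
  refine ⟨LinearMap.pi fun i => x i ∘ₗ LinearMap.proj i,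
    LinearMap.pi fun i => y i ∘ₗ LinearMap.proj i, LinearMap.ext fun v => funext fun i => ?_⟩
  simp only [LinearMap.add_apply, LinearMap.smul_apply, Pi.add_apply, Pi.smul_apply, hpow,
    LinearMap.pi_apply, LinearMap.comp_apply, LinearMap.proj_apply, h]

lemma exists_smul_pow_eq_smulRight (hβ : β ≠ 0) (hl : 1 ≤ l) (f : V →ₗ[F] F) (u : V) {b : F}
    (hb : b ≠ 0) (hfu : f u = β * b ^ l) :
    ∃ y : Module.End F V, f.smulRight u = β • y ^ l := by
  have hpow : ∀ n : ℕ, (f.smulRight u : Module.End F V) ^ (n + 1) = f u ^ n • f.smulRight u := by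
    intro n
    induction n with
    | zero => simp
    | succ n ih =>
      rw [pow_succ, ih]
      ext v
      simp only [Module.End.mul_apply, LinearMap.smul_apply, LinearMap.smulRight_apply, map_smul,
        smul_smul]
      congr 1
      ring
  obtain ⟨n, rfl⟩ : ∃ n, l = n + 1 := ⟨l - 1, by omega⟩
  -- With `R` the rank-one map, `R ^ (n + 1) = (f u) ^ n • R`. The scalar must therefore satisfy `β
  -- c ^ (n + 1) (f u) ^ n = 1`, and `c = b / f u` does.
  refine ⟨(b / f u) • f.smulRight u, ?_⟩
  rw [_root_.smul_pow, hpow, smul_smul, smul_smul]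
  have h0 : f u ≠ 0 := hfu ▸ mul_ne_zero hβ (pow_ne_zero _ hb)
  have : β * ((b / f u) ^ (n + 1) * f u ^ n) = 1 := by
    rw [div_pow, pow_succ (f u)]
    field_simp
    exact hfu.symm
  rw [mul_assoc, this, one_smul]

lemma linearIndependent_pow_of_aeval {A : Type*} [CommRing A] [Algebra F A] (w : A) (n : ℕ)
    (h : ∀ p : F[X], p.degree < n → aeval w p = 0 → p = 0) :
    LinearIndependent F fun i : Fin n => w ^ (i : ℕ) := by
  rw [Fintype.linearIndependent_iff]
  intro g hg i
  have hp := h (∑ i : Fin n, C (g i) * X ^ (i : ℕ)) ?_ (by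
    simpa [map_sum, Algebra.smul_def] using hg)
  · have := congrArg (fun p => p.coeff i) hp
    simpa [finsetSum_coeff, coeff_C_mul, coeff_X_pow, Fin.val_inj] using this
  · rw [degree_lt_iff_coeff_zero]
    intro m hm
    simp only [finsetSum_coeff, coeff_C_mul, coeff_X_pow]
    refine Finset.sum_eq_zero fun j _ => ?_
    rw [if_neg (by omega), mul_zero]

/-- A cyclic endomorphism `T` differs by an endomorphism of rank one from any other cyclic
endomorphism in the same dimension. If the latter is `α` times a `k`-th power and the traces differ
by `β bˡ` with `b ≠ 0`, then `T` is a two-power sum. -/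
lemma isTwoPowerSum_of_cyclic {n : ℕ} (hβ : β ≠ 0) (hl : 1 ≤ l) {T : Module.End F V}
    (v : Module.Basis (Fin (n + 1)) F V) (hv : ∀ i : Fin n, T (v i.castSucc) = v i.succ)
    {A : Type*} [CommRing A] [Algebra F A] (hA : Module.finrank F A = n + 1) (z : A)
    (hz : LinearIndependent F fun i : Fin (n + 1) => (α • z ^ k) ^ (i : ℕ)) {b : F} (hb : b ≠ 0)
    (htr : LinearMap.trace F V T = Algebra.trace F A (α • z ^ k) + β * b ^ l) :
    IsTwoPowerSum α β k l T := by
  have hfin : FiniteDimensional F A := Module.finite_of_finrank_pos (by omega)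
  let c := basisOfLinearIndependentOfCardEqFinrank hz (by simp [hA])
  have hc : ∀ i, c i = (α • z ^ k) ^ (i : ℕ) := fun i => by simp [c]
  let e : A ≃ₗ[F] V := c.equiv v (Equiv.refl _)
  have hec : ∀ i, e (c i) = v i := fun i => by simp [e]
  have hev : ∀ i, e.symm (v i) = c i := fun i => by rw [← hec, e.symm_apply_apply]
  let S : Module.End F V := LinearEquiv.conjAlgEquiv F e (LinearMap.mulLeft F (α • z ^ k))
  have hS : ∀ i : Fin n, S (v i.castSucc) = v i.succ := by
    intro i
    simp only [S, LinearEquiv.conjAlgEquiv_apply, LinearMap.comp_apply, LinearEquiv.coe_coe, hev,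
      LinearMap.mulLeft_apply]
    rw [hc, ← hec i.succ, hc, Fin.val_castSucc, Fin.val_succ, pow_succ' _ (i : ℕ)]
  -- Both maps shift the basis, so they can differ only on the last vector.
  have hR : T - S = (v.coord (Fin.last n)).smulRight ((T - S) (v (Fin.last n))) := by
    refine v.ext fun i => ?_
    induction i using Fin.lastCases with
    | last => simp
    | cast i =>
      rw [LinearMap.sub_apply, hv, hS, sub_self, LinearMap.smulRight_apply, Module.Basis.coord_apply,
        Module.Basis.repr_self, Finsupp.single_eq_of_ne (Fin.castSucc_lt_last i).ne', zero_smul]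
  have hfinV : FiniteDimensional F V := v.finiteDimensional_of_finite
  have htrS : LinearMap.trace F V S = Algebra.trace F A (α • z ^ k) :=
    LinearMap.trace_conj' _ e
  have hcoord : (v.coord (Fin.last n)) ((T - S) (v (Fin.last n))) = β * b ^ l := by
    rw [← LinearMap.trace_smulRight, ← hR, map_sub, htr, htrS, add_sub_cancel_left]
  obtain ⟨y, hy⟩ := exists_smul_pow_eq_smulRight hβ hl _ _ hb hcoord
  refine ⟨LinearEquiv.conjAlgEquiv F e (LinearMap.mulLeft F z), y, ?_⟩
  rw [← hy, ← hR, ← map_pow, ← map_smul, LinearMap.pow_mulLeft]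
  have : α • LinearMap.mulLeft F (z ^ k) = LinearMap.mulLeft F (α • z ^ k) := by
    ext; simp
  rw [this]
  simp [S]

/-- If every cyclic endomorphism is a two-power sum, then so is every endomorphism. -/
lemma isTwoPowerSum_of_forall_cyclic.{u, v} {F : Type u} [Field F] {α β : F} {V : Type v}
    [AddCommGroup V] [Module F V] [FiniteDimensional F V] {k l : ℕ}
    (hcyc : ∀ (W : Type u) [AddCommGroup W] [Module F W] (n : ℕ) (T : Module.End F W)
      (v : Module.Basis (Fin (n + 1)) F W), (∀ i : Fin n, T (v i.castSucc) = v i.succ) →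
      IsTwoPowerSum α β k l T)
    (T : Module.End F V) : IsTwoPowerSum α β k l T := by
  classical
  obtain ⟨ι, _, p, hp, m, ⟨e⟩⟩ := Module.equiv_directSum_of_isTorsion
    (Module.AEval.isTorsion_of_finiteDimensional F V T)
  have hquot : ∀ i, IsTwoPowerSum α β k l
      (Algebra.lsmul F F (F[X] ⧸ F[X] ∙ p i ^ m i) (X : F[X])) := by
    intro i
    have h0 : p i ^ m i ≠ 0 := pow_ne_zero _ (hp i).ne_zero
    -- `AdjoinRoot` is this quotient by definition; the identity map carries over the power basis,
    -- which multiplication by `X` shifts.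
    let g : AdjoinRoot (p i ^ m i) ≃ₗ[F] (F[X] ⧸ F[X] ∙ p i ^ m i) :=
      { toFun := fun x => x
        invFun := fun x => x
        left_inv := fun _ => rfl
        right_inv := fun _ => rfl
        map_add' := fun _ _ => rfl
        map_smul' := fun a x => by
          induction x using AdjoinRoot.induction_on with
          | ih q => rfl }
    have hg : ∀ x, g (AdjoinRoot.root _ * x) = (X : F[X]) • g x := fun x => by
      induction x using AdjoinRoot.induction_on with
      | ih q => rfl
    let pb := AdjoinRoot.powerBasis h0
    rcases hd : pb.dim with _ | n
    -- The exponent `m i` may be zero, and the summand is then trivial.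
    · have : IsEmpty (Fin pb.dim) := by rw [hd]; infer_instance
      have : Subsingleton (F[X] ⧸ F[X] ∙ p i ^ m i) :=
        (pb.basis.map g).repr.toEquiv.subsingleton
      exact ⟨0, 0, LinearMap.ext fun _ => Subsingleton.elim _ _⟩
    · refine hcyc _ n _ ((pb.basis.reindex (finCongr hd)).map g) ?_
      intro i
      simp only [Module.Basis.map_apply, Module.Basis.reindex_apply, PowerBasis.basis_eq_pow,
        Algebra.lsmul_coe, ← hg, finCongr_symm, finCongr_apply, Fin.val_cast, Fin.val_castSucc,
        Fin.val_succ]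
      rw [pow_succ']
      rfl
  let E : V ≃ₗ[F] ∀ i, F[X] ⧸ F[X] ∙ p i ^ m i :=
    ((Module.AEval'.of T).trans (e.restrictScalars F)).trans
      (DirectSum.linearEquivFunOnFintype F ι fun i => F[X] ⧸ F[X] ∙ p i ^ m i)
  have hE : ∀ v i, E (T v) i = (X : F[X]) • E v i := by
    intro v i
    have : e (Module.AEval'.of T (T v)) = (X : F[X]) • e (Module.AEval'.of T v) := by
      rw [← map_smul, Module.AEval'.X_smul_of]
    simp only [E, LinearEquiv.trans_apply, LinearEquiv.restrictScalars_apply,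
      DirectSum.linearEquivFunOnFintype_apply]
    rw [this]
    rfl
  refine (IsTwoPowerSum.pi hquot).conj E.symm fun w => ?_
  rw [LinearEquiv.symm_apply_eq]
  ext1 i
  rw [hE, E.apply_symm_apply]
  rfl

end TwoPowerSum

lemma diagonalWordMap_update_update {F : Type*} [Field F] {m : ℕ} {k : Fin m → ℕ}
    (hk : ∀ i, 1 ≤ k i) (δ : Fin m → F) (n : ℕ) {i j : Fin m} (hij : i ≠ j)
    (x y : Matrix (Fin n) (Fin n) F) :
    diagonalWordMap k δ n (Function.update (Function.update 0 i x) j y) =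
      δ i • x ^ k i + δ j • y ^ k j := by
  rw [diagonalWordMap, ← Finset.sum_subset (Finset.subset_univ {i, j}), Finset.sum_pair hij]
  · simp only [Function.update_self, Function.update_of_ne hij]
  · intro a _ ha
    simp only [Finset.mem_insert, Finset.mem_singleton, not_or] at ha
    rw [Function.update_of_ne ha.2, Function.update_of_ne ha.1, Pi.zero_apply,
      zero_pow (by have := hk a; omega), smul_zero]

lemma surjective_diagonalWordMap_of_isTwoPowerSum {F : Type*} [Field F] {m : ℕ} {k : Fin m → ℕ}
    (hk : ∀ i, 1 ≤ k i) (δ : Fin m → F) (n : ℕ) {i j : Fin m} (hij : i ≠ j)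
    (h : ∀ T : Module.End F (Fin n → F), IsTwoPowerSum (δ i) (δ j) (k i) (k j) T) :
    Function.Surjective (diagonalWordMap k δ n) := by
  intro M
  obtain ⟨x, y, hxy⟩ := h (Matrix.toLin' M)
  refine ⟨Function.update (Function.update 0 i (LinearMap.toMatrix' x)) j
    (LinearMap.toMatrix' y), ?_⟩
  rw [diagonalWordMap_update_update hk δ n hij]
  have := congrArg LinearMap.toMatrixAlgEquiv' hxy
  simp only [map_add, map_smul, map_pow] at this
  exact this.symm.trans (LinearMap.toMatrix'_toLin' M)

/-! ### Large finite fields. -/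

section FiniteFields

open Polynomial IntermediateField

lemma sum_Ico_pow_le_two_mul_pow {q : ℕ} (hq : 2 ≤ q) (n : ℕ) :
    ∑ r ∈ Finset.Ico 1 (n + 1), q ^ r ≤ 2 * q ^ n := by
  induction n with
  | zero => simp
  | succ n ih =>
    rw [Finset.sum_Ico_succ_top (by omega), pow_succ]
    nlinarith [Nat.mul_le_mul_left (q ^ n) hq]

variable {F L : Type*} [Field F] [Field L] [Algebra F L] [Finite L]

/-- The subfield `F⟮w⟯` has `q ^ d` elements, where `d` is the degree of `w`. -/
lemma pow_natCard_pow_natDegree_minpoly (w : L) :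
    w ^ Nat.card F ^ (minpoly F w).natDegree = w := by
  have hint : IsIntegral F w := .of_finite F w
  have hF : Finite F := Finite.of_injective _ (algebraMap F L).injective
  have : Fintype F⟮w⟯ := Fintype.ofFinite _
  have h := FiniteField.pow_card (AdjoinSimple.gen F w)
  rw [← Nat.card_eq_fintype_card, Module.natCard_eq_pow_finrank (K := F),
    IntermediateField.adjoin.finrank hint] at h
  simpa using congrArg (algebraMap F⟮w⟯ L) h

/-- A scaled `k`-th power in an extension `L` of a large finite field `F` which generates `L`
and whose trace avoids a given value. -/
lemma exists_generator_smul_pow_trace_ne {k : ℕ} (hk : 1 ≤ k) (hq : 3 * k < Nat.card F) {α : F}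
    (hα : α ≠ 0) (t : F) :
    ∃ z : L, (∀ p : F[X], p.degree < Module.finrank F L → aeval (α • z ^ k) p = 0 → p = 0) ∧
      Algebra.trace F L (α • z ^ k) ≠ t := by
  classical
  have hF : Finite F := Finite.of_injective _ (algebraMap F L).injective
  set q := Nat.card F with hqdef
  obtain ⟨n, hn⟩ : ∃ n, Module.finrank F L = n + 1 :=
    ⟨Module.finrank F L - 1, by have := Module.finrank_pos (R := F) (M := L); omega⟩
  have hq1 : 1 < q := by omega
  -- `P₁` vanishes at elements of trace `t`, and `P₂` at elements of degree at most `n`. After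
  -- substituting `c X ^ k` their product has degree at most `3 k q ^ n < q ^ (n + 1) = |L|`, so
  -- some `z` is not a root.
  let P₁ : L[X] := ∑ i ∈ Finset.range (n + 1), X ^ q ^ i - C (algebraMap F L t)
  let P₂ : L[X] := ∏ r ∈ Finset.Ico 1 (n + 1), (X ^ q ^ r - X)
  have hP₁ : P₁ ≠ 0 := by
    intro h
    have h' := congrArg (fun p => p.coeff (q ^ n)) h
    simp only [P₁, coeff_sub, finsetSum_coeff, coeff_X_pow, coeff_C,
      if_neg (pow_pos (by omega : 0 < q) n).ne', coeff_zero, sub_zero] at h'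
    rw [Finset.sum_eq_single n] at h'
    · simp at h'
    · intro i _ hi
      exact if_neg fun h => hi (Nat.pow_right_injective hq1 h).symm
    · simp
  have hdeg₁ : P₁.natDegree ≤ q ^ n := by
    refine (natDegree_sub_C).trans_le (natDegree_sum_le_of_forall_le _ _ fun i hi => ?_)
    rw [natDegree_X_pow]
    exact Nat.pow_le_pow_right (by omega) (by have := Finset.mem_range.1 hi; omega)
  have hP₂ : P₂ ≠ 0 := Finset.prod_ne_zero_iff.2 fun r hr =>
    FiniteField.X_pow_card_sub_X_ne_zero L
      (Nat.one_lt_pow (by have := (Finset.mem_Ico.1 hr).1; omega) hq1)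
  have hdeg₂ : P₂.natDegree ≤ 2 * q ^ n := by
    refine (natDegree_prod_le _ _).trans (le_trans (Finset.sum_le_sum fun r hr => ?_)
      (sum_Ico_pow_le_two_mul_pow hq1 n))
    exact (FiniteField.X_pow_card_sub_X_natDegree_eq L
      (Nat.one_lt_pow (by have := (Finset.mem_Ico.1 hr).1; omega) hq1)).le
  let c : L := algebraMap F L α
  have hc : c ≠ 0 := (_root_.map_ne_zero _).2 hα
  have hmon : (C c * X ^ k : L[X]).natDegree = k := natDegree_C_mul_X_pow k c hc
  have hQ : (P₁ * P₂).comp (C c * X ^ k) ≠ 0 := by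
    rw [Ne, comp_eq_zero_iff, not_or, not_and]
    refine ⟨mul_ne_zero hP₁ hP₂, fun _ h => ?_⟩
    rw [h, natDegree_C] at hmon
    omega
  have hcard : Nat.card L = q ^ (n + 1) := by
    rw [Module.natCard_eq_pow_finrank (K := F), hn]
  have hQdeg : ((P₁ * P₂).comp (C c * X ^ k)).natDegree < Cardinal.mk L := by
    rw [← Nat.cast_card, Nat.cast_lt, natDegree_comp, hmon, hcard]
    calc (P₁ * P₂).natDegree * k ≤ (q ^ n + 2 * q ^ n) * k :=
          Nat.mul_le_mul_right _ (natDegree_mul_le.trans (add_le_add hdeg₁ hdeg₂))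
      _ = q ^ n * (3 * k) := by ring
      _ < q ^ n * q := Nat.mul_lt_mul_of_pos_left hq (pow_pos (by omega) n)
      _ = q ^ (n + 1) := (pow_succ q n).symm
  obtain ⟨z, hz⟩ := exists_eval_ne_zero_of_natDegree_lt_card _ hQ hQdeg
  have hw : eval z (C c * X ^ k) = α • z ^ k := by simp [c, Algebra.smul_def]
  rw [eval_comp, hw, eval_mul, mul_ne_zero_iff] at hz
  refine ⟨z, fun p hp hpz => ?_, fun htr => hz.1 ?_⟩
  · by_contra hp0
    refine hz.2 ?_
    have hint : IsIntegral F (α • z ^ k) := .of_finite F _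
    have hlt : (minpoly F (α • z ^ k)).natDegree < n + 1 := by
      have := natDegree_le_of_dvd (minpoly.dvd F _ hpz) hp0
      rw [hn, ← natDegree_lt_iff_degree_lt hp0] at hp
      omega
    simp only [P₂, eval_prod]
    refine Finset.prod_eq_zero (Finset.mem_Ico.2 ⟨minpoly.natDegree_pos hint, hlt⟩) ?_
    simp [hqdef, pow_natCard_pow_natDegree_minpoly]
  · have := FiniteField.algebraMap_trace_eq_sum_pow F L (α • z ^ k)
    rw [htr, hn] at this
    simp [P₁, eval_finsetSum, this, hqdef]

/-- A polynomial killing `(a, w)` is `(X - a) r`; as `w ≠ a` in a domain, `r` kills `w` and has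
smaller degree. -/
lemma eq_zero_of_aeval_prod_eq_zero {A : Type*} [CommRing A] [IsDomain A] [Algebra F A] {a : F}
    {w : A} {n : ℕ} (hw : ∀ p : F[X], p.degree < n → aeval w p = 0 → p = 0)
    (haw : w ≠ algebraMap F A a) (p : F[X]) (hp : p.degree < (n + 1 : ℕ))
    (hpw : aeval ((a, w) : F × A) p = 0) : p = 0 := by
  rw [aeval_prod_apply] at hpw
  obtain ⟨h1, h2⟩ := Prod.mk.inj hpw
  have hroot : IsRoot p a := by simpa using h1
  obtain ⟨r, rfl⟩ := dvd_iff_isRoot.2 hroot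
  by_cases hr : r = 0
  · simp [hr]
  refine absurd (hw r ?_ ?_) hr
  · have h0 : (X - C a) * r ≠ 0 := mul_ne_zero (X_sub_C_ne_zero a) hr
    rw [← natDegree_lt_iff_degree_lt h0, natDegree_mul (X_sub_C_ne_zero a) hr,
      natDegree_X_sub_C] at hp
    rw [← natDegree_lt_iff_degree_lt hr]
    omega
  · rw [map_mul] at h2
    refine (mul_eq_zero.1 h2).resolve_left ?_
    simpa [sub_eq_zero] using haw

lemma isTwoPowerSum_of_card_gt {F V : Type*} [Field F] [Finite F] [AddCommGroup V] [Module F V]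
    [FiniteDimensional F V] {k l : ℕ} (hk : 1 ≤ k) (hl : 1 ≤ l)
    (hq : 64 * (k * l) ^ 4 < Nat.card F) {α β : F} (hα : α ≠ 0) (hβ : β ≠ 0)
    (T : Module.End F V) : IsTwoPowerSum α β k l T := by
  refine isTwoPowerSum_of_forall_cyclic (fun W _ _ n T v hv => ?_) T
  -- In dimension one no room is left for `L`, and the claim is a scalar equation.
  rcases Nat.eq_zero_or_pos n with rfl | hn
  · obtain ⟨a, b, hab⟩ : ∃ a b : F, α * a ^ k + β * b ^ l = v.repr (T (v 0)) 0 := by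
      by_cases h0 : v.repr (T (v 0)) 0 = 0
      · exact ⟨0, 0, by simp [h0, zero_pow (by omega : k ≠ 0), zero_pow (by omega : l ≠ 0)]⟩
      · obtain ⟨a, b, -, h, -⟩ := exists_diagonal_eq_of_card_gt hk hl hq hα hβ h0 0
        exact ⟨a, b, h⟩
    refine ⟨a • 1, b • 1, v.ext fun i => ?_⟩
    rw [Fin.fin_one_eq_zero i, ← v.sum_repr (T (v 0))]
    simp [_root_.smul_pow, ← hab, add_smul, smul_smul]
  · obtain ⟨p, hp⟩ := CharP.exists F
    have : Fact p.Prime := ⟨CharP.char_is_prime F p⟩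
    have : NeZero n := ⟨hn.ne'⟩
    have hK : 3 * k < Nat.card F := by
      have h1 : k ≤ k * l := Nat.le_mul_of_pos_right k hl
      have h2 : k * l ≤ (k * l) ^ 4 := Nat.le_self_pow (by norm_num) _
      omega
    let L := FiniteField.Extension F p n
    have hL : Module.finrank F L = n := FiniteField.finrank_extension F p n
    obtain ⟨z, hz, htr⟩ := exists_generator_smul_pow_trace_ne (L := L) hk hK hα
      (LinearMap.trace F W T)
    -- `α a ^ k` must differ from `α z ^ k` for the pair to generate `F × L`. This forbids at most
    -- one value in `F`; `r = 0` is a dummy when it forbids none.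
    obtain ⟨r, hr⟩ : ∃ r : F, ∀ a : F, α • z ^ k = algebraMap F L a → a = r := by
      by_cases h : ∃ r : F, α • z ^ k = algebraMap F L r
      · obtain ⟨r, h⟩ := h
        exact ⟨r, fun a ha => (algebraMap F L).injective (ha.symm.trans h)⟩
      · exact ⟨0, fun a ha => absurd ⟨a, ha⟩ h⟩
    obtain ⟨a, b, hb, hab, har⟩ := exists_diagonal_eq_of_card_gt hk hl hq hα hβ
      (sub_ne_zero.2 htr.symm) r
    have hw : α • ((a, z) : F × L) ^ k = (α * a ^ k, α • z ^ k) := rfl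
    refine isTwoPowerSum_of_cyclic hβ hl v hv (A := F × L) (by simp [hL, add_comm]) (a, z) ?_ hb ?_
    · rw [hw]
      refine linearIndependent_pow_of_aeval _ _ fun p hp hpw => ?_
      exact eq_zero_of_aeval_prod_eq_zero (by simpa only [hL] using hz) (fun h => har (hr _ h)) p hp hpw
    · rw [hw, Algebra.trace_prod_apply, Algebra.trace_self_apply]
      linear_combination -hab

end FiniteFields

/-! ### Real numbers with an odd exponent. -/

section RealNumbers

open Polynomial

lemma Odd.exists_pow_eq {k : ℕ} (hk : Odd k) (x : ℝ) : ∃ z : ℝ, z ^ k = x := by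
  rcases le_total 0 x with hx | hx
  · exact ⟨x ^ ((k : ℝ)⁻¹), Real.rpow_inv_natCast_pow hx hk.pos.ne'⟩
  · exact ⟨-(-x) ^ ((k : ℝ)⁻¹), by
      rw [hk.neg_pow, Real.rpow_inv_natCast_pow (neg_nonneg.2 hx) hk.pos.ne', neg_neg]⟩

lemma isTwoPowerSum_of_odd {V : Type*} [AddCommGroup V] [Module ℝ V]
    [FiniteDimensional ℝ V] {k l : ℕ} (hk : Odd k) (hl : 1 ≤ l) {α β : ℝ} (hα : α ≠ 0)
    (hβ : β ≠ 0) (T : Module.End ℝ V) : IsTwoPowerSum α β k l T := by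
  refine isTwoPowerSum_of_forall_cyclic (fun W _ _ n T v hv => ?_) T
  -- The eigenvalues `i + M` are distinct and sum to `tr T - β`, which leaves trace `β = β * 1 ^ l`
  -- for the rank-one part.
  let M : ℝ := (LinearMap.trace ℝ W T - β - ∑ i : Fin (n + 1), (i : ℝ)) / (n + 1)
  have hroot : ∀ i : Fin (n + 1), ∃ z : ℝ, α * z ^ k = i + M := fun i => by
    obtain ⟨z, hz⟩ := hk.exists_pow_eq ((i + M) / α)
    exact ⟨z, by rw [hz]; field_simp⟩
  choose z hz using hroot
  have hw : α • z ^ k = fun i : Fin (n + 1) => (i : ℝ) + M := funext fun i => hz i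
  refine isTwoPowerSum_of_cyclic hβ hl v hv (A := Fin (n + 1) → ℝ) (by simp) z ?_
    one_ne_zero ?_
  · rw [hw]
    refine linearIndependent_pow_of_aeval _ _ fun p hp hpw => ?_
    refine eq_zero_of_degree_lt_of_eval_index_eq_zero (s := Finset.univ)
      (v := fun i : Fin (n + 1) => (i : ℝ) + M) ?_ (by simpa using hp) fun i _ => ?_
    · intro i _ j _ hij
      simpa [Fin.val_inj] using hij
    · have := congrArg (Pi.evalAlgHom ℝ (fun _ : Fin (n + 1) => ℝ) i) hpw
      rw [← aeval_algHom_apply] at this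
      simpa using this
  · rw [hw, Algebra.trace_eq_matrix_trace (Pi.basisFun ℝ (Fin (n + 1)))]
    simp only [Matrix.trace, Matrix.diag_apply, Algebra.leftMulMatrix_eq_repr_mul,
      Pi.basisFun_repr, Pi.mul_apply, Pi.basisFun_apply, Pi.single_eq_same, mul_one, one_pow]
    rw [Finset.sum_add_distrib]
    simp only [Finset.sum_const, Finset.card_univ, Fintype.card_fin, nsmul_eq_mul, M]
    push_cast
    have : (n + 1 : ℝ) ≠ 0 := by positivity
    field_simp
    ring

end RealNumbers

/-! ### Complex numbers and diagonalisable summands. -/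

section Diagonalisable

lemma Matrix.exists_eq_conj_diagonal {K : Type*} [Field K] {n : ℕ} (M : Matrix (Fin n) (Fin n) K)
    (d : Fin n → K) (hd : Function.Injective d)
    (h : ∀ i, Module.End.HasEigenvalue (Matrix.toLin' M) (d i)) :
    ∃ P : GL (Fin n) K, M = (P : Matrix (Fin n) (Fin n) K) * Matrix.diagonal d *
      ((P⁻¹ : GL (Fin n) K) : Matrix (Fin n) (Fin n) K) := by
  choose v hv using fun i => (h i).exists_hasEigenvector
  have hli : LinearIndependent K v :=
    Module.End.eigenvectors_linearIndependent' (Matrix.toLin' M) d hd v hv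
  let Q : Matrix (Fin n) (Fin n) K := Matrix.of fun r i => v i r
  have hQ : IsUnit Q := Matrix.linearIndependent_cols_iff_isUnit.1 hli
  obtain ⟨P, hP⟩ := hQ
  refine ⟨P, (Units.eq_mul_inv_iff_mul_eq P).2 ?_⟩
  rw [hP]
  ext r i
  have := congrFun (hv i).apply_eq_smul r
  rw [Matrix.mul_diagonal, mul_comm]
  simpa [Matrix.mulVec, dotProduct, Matrix.mul_apply, Q] using this

lemma isDiagonalisableMatrix_diagonal {K : Type*} [Field K] {n : ℕ} (d : Fin n → K) :
    IsDiagonalisableMatrix (Matrix.diagonal d) := ⟨1, d, by simp⟩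

lemma IsDiagonalisableMatrix.exists_smul_pow_eq {n k : ℕ} (hk : 1 ≤ k) {c : ℂ} (hc : c ≠ 0)
    {A : Matrix (Fin n) (Fin n) ℂ} (hA : IsDiagonalisableMatrix A) :
    ∃ x, IsDiagonalisableMatrix x ∧ c • x ^ k = A := by
  obtain ⟨P, d, rfl⟩ := hA
  choose e he using fun i => IsAlgClosed.exists_pow_nat_eq (d i / c) hk
  refine ⟨_, ⟨P, e, rfl⟩, ?_⟩
  have hd : c • Matrix.diagonal e ^ k = Matrix.diagonal d := by
    rw [Matrix.diagonal_pow, ← Matrix.diagonal_smul]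
    congr 1
    ext i
    simp only [Pi.smul_apply, Pi.pow_apply, he, smul_eq_mul]
    field_simp
  rw [Units.conj_pow, ← hd, Matrix.mul_smul, Matrix.smul_mul]

lemma pow_card_le_norm_prod_sub {z : ℂ} {r : ℝ} (hr : 0 ≤ r) (s : Multiset ℂ)
    (h : ∀ a ∈ s, r ≤ ‖z - a‖) : r ^ Multiset.card s ≤ ‖(s.map fun a => z - a).prod‖ := by
  induction s using Multiset.induction with
  | empty => simp
  | cons a s ih =>
    rw [Multiset.card_cons, Multiset.map_cons, Multiset.prod_cons, norm_mul, pow_succ']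
    exact mul_le_mul (h a (Multiset.mem_cons_self a s))
      (ih fun b hb => h b (Multiset.mem_cons_of_mem hb)) (by positivity) (norm_nonneg _)

/-- The determinant is the characteristic polynomial at `z`, so its norm is the product of the
distances from `z` to the `n` eigenvalues. -/
lemma exists_root_charpoly_near {n : ℕ} (M : Matrix (Fin n) (Fin n) ℂ) (z : ℂ) {r : ℝ}
    (hr : 0 ≤ r) (h : ‖(Matrix.scalar (Fin n) z - M).det‖ < r ^ n) :
    ∃ w : ℂ, M.charpoly.IsRoot w ∧ ‖z - w‖ < r := by
  by_contra! hcon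
  have hsplit : M.charpoly.Splits := IsAlgClosed.splits _
  have hcard : Multiset.card M.charpoly.roots = n := by
    rw [← hsplit.natDegree_eq_card_roots, Matrix.charpoly_natDegree_eq_dim, Fintype.card_fin]
  have h1 := pow_card_le_norm_prod_sub (z := z) hr M.charpoly.roots
    fun a ha => hcon a (Polynomial.isRoot_of_mem_roots ha)
  rw [hcard, ← hsplit.eval_eq_prod_roots_of_monic M.charpoly_monic, Matrix.eval_charpoly] at h1
  exact h.not_ge h1

/-- Every complex matrix is the sum of a diagonalisable matrix and a diagonal one: a small
perturbation of `diag(0, …, n - 1)` still has `n` distinct eigenvalues. -/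
lemma exists_isDiagonalisableMatrix_add_diagonal {n : ℕ} (A : Matrix (Fin n) (Fin n) ℂ) :
    ∃ (B : Matrix (Fin n) (Fin n) ℂ) (d : Fin n → ℂ),
      IsDiagonalisableMatrix B ∧ A = B + Matrix.diagonal d := by
  let D : Matrix (Fin n) (Fin n) ℂ := Matrix.diagonal fun i => ((i : ℕ) : ℂ)
  -- The determinant vanishes at `s = 0`, so it is small for small nonzero `s`. Radius `1 / 4` keeps
  -- the discs around `0, …, n - 1` disjoint, which makes the eigenvalues found in them distinct.
  have hev : ∀ i : Fin n, ∀ᶠ s : ℂ in nhdsWithin 0 {0}ᶜ,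
      ‖(Matrix.scalar (Fin n) ((i : ℕ) : ℂ) - (D + s • A)).det‖ < (1 / 4 : ℝ) ^ n := by
    intro i
    have hcont : Continuous fun s : ℂ =>
        ‖(Matrix.scalar (Fin n) ((i : ℕ) : ℂ) - (D + s • A)).det‖ := by fun_prop
    refine (hcont.continuousAt.eventually_lt continuousAt_const ?_).filter_mono
      nhdsWithin_le_nhds
    have : (Matrix.scalar (Fin n) ((i : ℕ) : ℂ) - (D + (0 : ℂ) • A)).det = 0 := by
      rw [zero_smul, add_zero, Matrix.scalar_apply, Matrix.diagonal_sub, Matrix.det_diagonal]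
      exact Finset.prod_eq_zero (Finset.mem_univ i) (sub_self _)
    rw [this, norm_zero]
    positivity
  obtain ⟨s, hs, hs0⟩ := ((Filter.eventually_all.2 hev).and self_mem_nhdsWithin).exists
  have hs0 : s ≠ 0 := hs0
  choose w hw hwi using fun i => exists_root_charpoly_near (D + s • A) _ (by norm_num) (hs i)
  have hinj : Function.Injective w := by
    intro i j hij
    have h1 : ‖((i : ℕ) : ℂ) - ((j : ℕ) : ℂ)‖ < 1 := by
      calc _ = ‖(((i : ℕ) : ℂ) - w i) - (((j : ℕ) : ℂ) - w j)‖ := by rw [hij]; congr 1; ring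
        _ ≤ _ := norm_sub_le _ _
        _ < 1 := by linarith [hwi i, hwi j]
    have h2 : ‖(((i : ℕ) - (j : ℕ) : ℤ) : ℂ)‖ < 1 := by push_cast; exact h1
    rw [Complex.norm_intCast] at h2
    have h3 : |((i : ℕ) - (j : ℕ) : ℤ)| < 1 := by exact_mod_cast h2
    rw [Int.abs_lt_one_iff] at h3
    exact Fin.ext (by omega)
  obtain ⟨P, hP⟩ := Matrix.exists_eq_conj_diagonal (D + s • A) w hinj fun i => by
    rw [Module.End.hasEigenvalue_iff_isRoot_charpoly, Matrix.charpoly_toLin']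
    exact hw i
  -- The splitting is `A = s⁻¹ (D + s A) - s⁻¹ D`, which needs `s ≠ 0`.
  refine ⟨s⁻¹ • (D + s • A), fun i => -(s⁻¹ * ((i : ℕ) : ℂ)), ⟨P, s⁻¹ • w, ?_⟩, ?_⟩
  · rw [Matrix.diagonal_smul, Matrix.mul_smul, Matrix.smul_mul, ← hP]
  · have : Matrix.diagonal (fun i : Fin n => -(s⁻¹ * ((i : ℕ) : ℂ))) = -(s⁻¹ • D) := by
      rw [← Matrix.diagonal_smul, ← Matrix.diagonal_neg]
      rfl
    rw [this, smul_add, smul_smul, inv_mul_cancel₀ hs0, one_smul]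
    abel

lemma surjOn_diagonalWordMap_isDiagonalisableMatrix {m : ℕ} {k : Fin m → ℕ} (hk : ∀ i, 1 ≤ k i)
    {i j : Fin m} (hij : i ≠ j) (n : ℕ) (δ : Fin m → ℂ) (hδ : ∀ i, δ i ≠ 0) :
    Set.SurjOn (diagonalWordMap k δ n) {x | ∀ i, IsDiagonalisableMatrix (x i)} Set.univ := by
  intro A _
  obtain ⟨B, d, hB, rfl⟩ := exists_isDiagonalisableMatrix_add_diagonal A
  obtain ⟨x, hx, hxB⟩ := hB.exists_smul_pow_eq (hk i) (hδ i)
  obtain ⟨y, hy, hyd⟩ := (isDiagonalisableMatrix_diagonal d).exists_smul_pow_eq (hk j) (hδ j)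
  refine ⟨Function.update (Function.update 0 i x) j y, fun a => ?_, ?_⟩
  · rcases eq_or_ne a j with rfl | haj
    · rwa [Function.update_self]
    rw [Function.update_of_ne haj]
    rcases eq_or_ne a i with rfl | hai
    · rwa [Function.update_self]
    rw [Function.update_of_ne hai]
    simpa using isDiagonalisableMatrix_diagonal (0 : Fin n → ℂ)
  · rw [diagonalWordMap_update_update hk δ n hij, hxB, hyd]

end Diagonalisable

theorem theorem1p3 (m : ℕ) (hm : 2 ≤ m) (k : Fin m → ℕ) (hk : ∀ i, 1 ≤ k i) :
    -- over the complex numbers, already with diagonalisable inputs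
    (∀ (n : ℕ) (δ : Fin m → ℂ), (∀ i, δ i ≠ 0) →
      Function.Surjective (diagonalWordMap k δ n) ∧
      Set.SurjOn (diagonalWordMap k δ n) {x | ∀ i, IsDiagonalisableMatrix (x i)} Set.univ) ∧
    -- over large finite fields, with a bound that depends only on the exponents
    (∃ N : ℕ, ∀ (F : Type*) [Field F] [Finite F], N < Nat.card F →
      ∀ (n : ℕ) (δ : Fin m → F), (∀ i, δ i ≠ 0) →
        Function.Surjective (diagonalWordMap k δ n)) ∧
    -- over the real numbers, when some exponent is odd
    ((∃ i, Odd (k i)) → ∀ (n : ℕ) (δ : Fin m → ℝ), (∀ i, δ i ≠ 0) →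
      Function.Surjective (diagonalWordMap k δ n)) := by
  have : Nontrivial (Fin m) := Fin.nontrivial_iff_two_le.2 hm
  obtain ⟨i, j, hij⟩ := exists_pair_ne (Fin m)
  refine ⟨fun n δ hδ => ?_, ⟨64 * (k i * k j) ^ 4, fun F _ _ hF n δ hδ => ?_⟩, ?_⟩
  · have h := surjOn_diagonalWordMap_isDiagonalisableMatrix hk hij n δ hδ
    exact ⟨Set.surjOn_univ.1 (h.mono (Set.subset_univ _) subset_rfl), h⟩
  · exact surjective_diagonalWordMap_of_isTwoPowerSum hk δ n hij fun T =>
      isTwoPowerSum_of_card_gt (hk i) (hk j) hF (hδ i) (hδ j) T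
  -- The odd exponent must belong to the summand with prescribed eigenvalues; its partner is any
  -- other index.
  · rintro ⟨i, hi⟩ n δ hδ
    obtain ⟨j, hji⟩ := exists_ne i
    exact surjective_diagonalWordMap_of_isTwoPowerSum hk δ n hji.symm fun T =>
      isTwoPowerSum_of_odd hi (hk j) (hδ i) (hδ j) T
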